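/- There is a universal constant $c_1\in(0,1)$ such that the following holds for every integer $d\ge 1$ and every norm $\|\cdot\|$ on $\mathbb{R}^d$. Let $Z\sim N(0,\mathbf{I}_d)$ be a standard Gaussian vector in $\mathbb{R}^d$, let $\|x\|_*=\sup_{\|y\|\le 1}\langle x,y\rangle$ be the dual norm of $\|\cdot\|$ with respect to the standard inner product, and for $\theta\in\mathbb{R}^d$ let $\mathbb{E}_\theta$ denote expectation when the observation is $Y=\theta+Z$. Then $$\frac{c_1 d^2}{(\mathbb{E}\|Z\|_*)^2}\;\le\;\inf_{\hat\theta}\,\sup_{\theta\in\mathbb{R}^d}\mathbb{E}_\theta\|\hat\theta(Y)-\theta\|^2\;\le\;\mathbb{E}\|Z\|^2,$$ where the infimum is over all estimators, i.e. all measurable functions $\hat\theta:\mathbb{R}^d\to\mathbb{R}^d$. Moreover, $\mathbb{E}\|Z\|_*$ is equal to the Gaussian width $\mathbb{E}\sup_{x\in K}\langle x,Z\rangle$ of the unit ball $K=\{x\in\mathbb{R}^d:\|x\|\le 1\}$. -/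

import Mathlib

open MeasureTheory ProbabilityTheory
open scoped ENNReal

noncomputable section

namespace GaussianLocation

/-- The dual norm `‖x‖_* = sup {⟨x, y⟩ : ‖y‖ ≤ 1}` of a norm `N` on Euclidean space `ℝ^d`.
(For a norm `N` the set on the right is nonempty and bounded.) -/
def dualNorm {d : ℕ} (N : Seminorm ℝ (EuclideanSpace ℝ (Fin d)))
    (x : EuclideanSpace ℝ (Fin d)) : ℝ :=
  sSup {r : ℝ | ∃ y : EuclideanSpace ℝ (Fin d), N y ≤ 1 ∧ r = inner ℝ x y}

/-- The Gaussian width `E sup {⟨x, Z⟩ : x ∈ K}`, `Z ∼ N(0, I_d)`, of a symmetric convex body `K`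
in `ℝ^d`. The supremum is nonnegative since `0 ∈ K`, and the expectation is taken in `[0, ∞]`. -/
def gaussianWidth {d : ℕ} (K : Set (EuclideanSpace ℝ (Fin d))) : ℝ≥0∞ :=
  ∫⁻ z, ENNReal.ofReal (sSup {r : ℝ | ∃ x ∈ K, r = inner ℝ x z})
    ∂(stdGaussian (EuclideanSpace ℝ (Fin d)))

/-- The law `P_θ` of the observation `Y = θ + Z`, where `Z ∼ N(0, I_d)`. -/
def obsLaw {d : ℕ} (θ : EuclideanSpace ℝ (Fin d)) : Measure (EuclideanSpace ℝ (Fin d)) :=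
  (stdGaussian (EuclideanSpace ℝ (Fin d))).map (fun z => θ + z)

/-- The risk `E_θ ‖est(Y) - θ‖²` of an estimator `est`, with values in `[0, ∞]`. -/
def risk {d : ℕ} (N : Seminorm ℝ (EuclideanSpace ℝ (Fin d)))
    (est : EuclideanSpace ℝ (Fin d) → EuclideanSpace ℝ (Fin d))
    (θ : EuclideanSpace ℝ (Fin d)) : ℝ≥0∞ :=
  ∫⁻ y, ENNReal.ofReal (N (est y - θ) ^ 2) ∂(obsLaw θ)

/-- The minimax risk: the infimum over all estimators, i.e. all measurable functions of the
observation, of the largest risk over all of `ℝ^d`. -/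
def minimaxRisk {d : ℕ} (N : Seminorm ℝ (EuclideanSpace ℝ (Fin d))) : ℝ≥0∞ :=
  ⨅ (est : EuclideanSpace ℝ (Fin d) → EuclideanSpace ℝ (Fin d)) (_ : Measurable est),
    ⨆ θ : EuclideanSpace ℝ (Fin d), risk N est θ

end GaussianLocation

end

namespace GaussianLocation


variable {d : ℕ}

/-! The upper bound is the constant risk of the estimator `id`. For the lower bound, put the prior
N(0, I) on θ: given Y, θ is Y/2 plus an independent Gaussian of covariance I/2, and by symmetry no
shift of it lowers the mean squared norm, so the Bayes risk is at least E N(Z)²/2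
(`half_lintegral_seminorm_sq_le_iSup_risk`). Duality ‖z‖² ≤ N(z) N_*(z) and Cauchy–Schwarz then give
d·m² ≤ (E‖Z‖)² ≤ E N(Z) · E N_*(Z), where m = E|g| for a standard real Gaussian g; squaring yields
the constant m⁴/2. -/

lemma continuous_seminorm (N : Seminorm ℝ (EuclideanSpace ℝ (Fin d))) : Continuous N :=
  continuousOn_univ.1 (N.convexOn.continuousOn isOpen_univ)

/-- A definite seminorm on Euclidean space dominates a positive multiple of the Euclidean norm. -/
lemma exists_pos_mul_norm_le (N : Seminorm ℝ (EuclideanSpace ℝ (Fin d)))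
    (hN : ∀ x, N x = 0 → x = 0) : ∃ m > 0, ∀ x, m * ‖x‖ ≤ N x := by
  rcases (Metric.sphere (0 : EuclideanSpace ℝ (Fin d)) 1).eq_empty_or_nonempty with h | h
  · refine ⟨1, one_pos, fun x ↦ ?_⟩
    by_cases hx : x = 0
    · simp [hx]
    · have : (‖x‖⁻¹ • x) ∈ Metric.sphere (0 : EuclideanSpace ℝ (Fin d)) 1 := by
        simp [norm_smul, hx]
      simp [h] at this
  · obtain ⟨y, hy, hmin⟩ := (isCompact_sphere (0 : EuclideanSpace ℝ (Fin d)) 1).exists_isMinOn h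
      (continuous_seminorm N).continuousOn
    have hy1 : ‖y‖ = 1 := by simpa using hy
    have hy0 : N y ≠ 0 := fun h0 ↦ by simp [hN y h0] at hy1
    refine ⟨N y, lt_of_le_of_ne (apply_nonneg N y) hy0.symm, fun x ↦ ?_⟩
    by_cases hx : x = 0
    · simp [hx]
    · have hx' : 0 < ‖x‖ := norm_pos_iff.2 hx
      have hmem : (‖x‖⁻¹ • x) ∈ Metric.sphere (0 : EuclideanSpace ℝ (Fin d)) 1 := by
        simp [norm_smul, hx]
      have hle : N y ≤ ‖x‖⁻¹ * N x := by
        have h1 := hmin hmem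
        simpa [map_smul_eq_mul] using h1
      rw [inv_mul_eq_div, le_div_iff₀ hx'] at hle
      exact hle

lemma bddAbove_inner_unitBall (N : Seminorm ℝ (EuclideanSpace ℝ (Fin d)))
    (hN : ∀ x, N x = 0 → x = 0) (x : EuclideanSpace ℝ (Fin d)) :
    BddAbove {r : ℝ | ∃ y : EuclideanSpace ℝ (Fin d), N y ≤ 1 ∧ r = inner ℝ x y} := by
  obtain ⟨m, hm, h⟩ := exists_pos_mul_norm_le N hN
  refine ⟨‖x‖ * m⁻¹, ?_⟩
  rintro r ⟨y, hy, rfl⟩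
  have hle : ‖y‖ ≤ m⁻¹ := by
    rw [← one_div, le_div_iff₀ hm, mul_comm]
    exact (h y).trans hy
  exact (real_inner_le_norm x y).trans (by gcongr)

lemma measurable_dualNorm (N : Seminorm ℝ (EuclideanSpace ℝ (Fin d)))
    (hN : ∀ x, N x = 0 → x = 0) : Measurable (dualNorm N) := by
  have hset (x : EuclideanSpace ℝ (Fin d)) :
      {r : ℝ | ∃ y : EuclideanSpace ℝ (Fin d), N y ≤ 1 ∧ r = inner ℝ x y}
        = Set.range fun y : {y // N y ≤ 1} ↦ inner ℝ x y.1 := by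
    ext r
    simp [eq_comm]
  have heq : dualNorm N = fun x ↦ ⨆ y : {y // N y ≤ 1}, inner ℝ x y.1 := by
    funext x
    rw [dualNorm, hset, iSup]
  rw [heq]
  -- A supremum of continuous functions, even uncountably many, is lower semicontinuous.
  refine (lowerSemicontinuous_ciSup (fun x ↦ ?_) fun y ↦ ?_).measurable
  · rw [← hset]
    exact bddAbove_inner_unitBall N hN x
  · exact Continuous.lowerSemicontinuous (by fun_prop)

lemma inner_le_mul_dualNorm (N : Seminorm ℝ (EuclideanSpace ℝ (Fin d)))
    (hN : ∀ x, N x = 0 → x = 0) (x y : EuclideanSpace ℝ (Fin d)) :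
    inner ℝ x y ≤ N y * dualNorm N x := by
  rcases (apply_nonneg N y).eq_or_lt with h | h
  · simp [hN y h.symm]
  · have hle : inner ℝ x ((N y)⁻¹ • y) ≤ dualNorm N x := by
      refine le_csSup (bddAbove_inner_unitBall N hN x) ⟨_, ?_, rfl⟩
      rw [map_smul_eq_mul, norm_inv, Real.norm_of_nonneg h.le, inv_mul_cancel₀ h.ne']
    rwa [real_inner_smul_right, inv_mul_le_iff₀ h] at hle

/-- Translating a centered Gaussian vector does not decrease its mean squared norm. -/
lemma lintegral_seminorm_sq_le_add (N : Seminorm ℝ (EuclideanSpace ℝ (Fin d))) (c : ℝ)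
    (w : EuclideanSpace ℝ (Fin d)) :
    ∫⁻ v, ENNReal.ofReal (N (c • v) ^ 2) ∂(stdGaussian (EuclideanSpace ℝ (Fin d)))
      ≤ ∫⁻ v, ENNReal.ofReal (N (w + c • v) ^ 2) ∂(stdGaussian (EuclideanSpace ℝ (Fin d))) := by
  have hc := continuous_seminorm N
  set μ := stdGaussian (EuclideanSpace ℝ (Fin d))
  have hneg : ∫⁻ v, ENNReal.ofReal (N (w + c • v) ^ 2) ∂μ
      = ∫⁻ v, ENNReal.ofReal (N (w - c • v) ^ 2) ∂μ := by
    conv_lhs => rw [show μ = μ.map (LinearIsometryEquiv.neg ℝ) from (stdGaussian_map _).symm]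
    rw [lintegral_map (by fun_prop) (by fun_prop)]
    simp [sub_eq_add_neg]
  have hpt (v : EuclideanSpace ℝ (Fin d)) :
      2 * ENNReal.ofReal (N (c • v) ^ 2)
        ≤ ENNReal.ofReal (N (w + c • v) ^ 2) + ENNReal.ofReal (N (w - c • v) ^ 2) := by
    rw [two_mul, ← ENNReal.ofReal_add (by positivity) (by positivity),
      ← ENNReal.ofReal_add (by positivity) (by positivity)]
    refine ENNReal.ofReal_le_ofReal ?_
    -- 2N(cv) ≤ N(w + cv) + N(w - cv); the two right-hand terms have the same law.
    have h := map_sub_le_add N (w + c • v) (w - c • v)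
    rw [show w + c • v - (w - c • v) = (2 : ℝ) • (c • v) by module, map_smul_eq_mul] at h
    norm_num at h
    nlinarith [apply_nonneg N (c • v), apply_nonneg N (w + c • v), apply_nonneg N (w - c • v),
      sq_nonneg (N (w + c • v) - N (w - c • v))]
  have h2 := lintegral_mono (μ := μ) hpt
  rw [lintegral_const_mul _ (by fun_prop), lintegral_add_left (by fun_prop), ← hneg,
    ← two_mul] at h2
  exact (ENNReal.mul_le_mul_iff_right (by simp) (by simp)).1 h2

/-- Half of the mean squared norm of a Gaussian vector bounds from below the Bayes risk for the
standard Gaussian prior, hence the worst-case risk. -/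
lemma half_lintegral_seminorm_sq_le_iSup_risk (N : Seminorm ℝ (EuclideanSpace ℝ (Fin d)))
    {est : EuclideanSpace ℝ (Fin d) → EuclideanSpace ℝ (Fin d)} (hest : Measurable est) :
    2⁻¹ * ∫⁻ z, ENNReal.ofReal (N z ^ 2) ∂(stdGaussian (EuclideanSpace ℝ (Fin d)))
      ≤ ⨆ θ, risk N est θ := by
  have hN := (continuous_seminorm N).measurable
  set μ := stdGaussian (EuclideanSpace ℝ (Fin d))
  set c : ℝ := √2 / 2 with hc
  have hcc : c ^ 2 = 2⁻¹ := by
    rw [hc]; nlinarith [Real.mul_self_sqrt (show (0 : ℝ) ≤ 2 by norm_num)]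
  -- Rotated coordinates: θ = c(u - v) and Z = c(u + v), so Y = 2cu depends on u alone and v is
  -- independent of the observation.
  have hrot : (μ.prod μ).map (ContinuousLinearMap.rotation (-(Real.pi / 4))) = μ.prod μ :=
    IsGaussian.map_rotation_eq_self_of_forall_strongDual_eq_zero
      integral_strongDual_stdGaussian _
  calc 2⁻¹ * ∫⁻ z, ENNReal.ofReal (N z ^ 2) ∂μ
      = ∫⁻ z, ENNReal.ofReal (N (c • z) ^ 2) ∂μ := by
        rw [← lintegral_const_mul _ (by fun_prop)]
        congr with z
        rw [map_smul_eq_mul, mul_pow, ENNReal.ofReal_mul (by positivity), Real.norm_eq_abs, sq_abs,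
          hcc, ENNReal.ofReal_inv_of_pos (by norm_num)]
        simp
    _ = ∫⁻ _u, ∫⁻ v, ENNReal.ofReal (N (c • v) ^ 2) ∂μ ∂μ := by simp
    _ ≤ ∫⁻ u, ∫⁻ v, ENNReal.ofReal
          (N ((est ((c • u + -c • v) + (c • u + c • v))) - (c • u + -c • v)) ^ 2) ∂μ ∂μ := by
        refine lintegral_mono fun u ↦ ?_
        refine (lintegral_seminorm_sq_le_add N c (est ((2 * c) • u) - c • u)).trans_eq ?_
        congr with v
        rw [show (c • u + -c • v) + (c • u + c • v) = (2 * c) • u by module]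
        congr 3
        module
    _ = ∫⁻ p, ENNReal.ofReal (N (est (p.1 + p.2) - p.1) ^ 2) ∂(μ.prod μ) := by
        conv_rhs => rw [← hrot]
        rw [lintegral_map (by fun_prop) (by fun_prop), lintegral_prod _ (by fun_prop)]
        simp [ContinuousLinearMap.rotation_apply, hc]
    _ = ∫⁻ θ, risk N est θ ∂μ := by
        rw [lintegral_prod _ (by fun_prop)]
        congr with θ
        rw [risk, obsLaw, lintegral_map (by fun_prop) (by fun_prop)]
    _ ≤ ∫⁻ _θ, ⨆ θ, risk N est θ ∂μ := lintegral_mono fun θ ↦ le_iSup (risk N est) θ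
    _ = ⨆ θ, risk N est θ := by simp

/-- The first absolute moment of the standard Gaussian distribution on the real line. -/
noncomputable def absMoment : ℝ≥0∞ := ∫⁻ x, ENNReal.ofReal |x| ∂(gaussianReal 0 1)

lemma absMoment_pos : 0 < absMoment := by
  refine pos_iff_ne_zero.2 fun h ↦ ?_
  rw [absMoment, lintegral_eq_zero_iff (by fun_prop)] at h
  have h0 : ∀ᵐ x ∂(gaussianReal 0 1), x = 0 := by
    filter_upwards [h] with x hx
    simpa using hx
  have := nullSingletonClass_gaussianReal (μ := 0) (v := 1) one_ne_zero
  have h1 : ∀ᵐ x ∂(gaussianReal 0 1), x ≠ 0 := by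
    simp [ae_iff]
  obtain ⟨x, hx, hx'⟩ := (h0.and h1).exists
  exact hx' hx

lemma lintegral_abs_eval_stdGaussian (i : Fin d) :
    ∫⁻ z, ENNReal.ofReal |z i| ∂(stdGaussian (EuclideanSpace ℝ (Fin d))) = absMoment := by
  have h := measurePreserving_eval_multivariateGaussian (μ := (0 : EuclideanSpace ℝ (Fin d)))
    (Matrix.PosSemidef.one (n := Fin d) (R := ℝ)) (i := i)
  rw [multivariateGaussian_zero_one] at h
  have h2 := h.lintegral_comp (f := fun x ↦ ENNReal.ofReal |x|) (by fun_prop)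
  simpa [absMoment] using h2

/-- Compare the ℓ¹ and ℓ² norms pointwise, then integrate coordinate by coordinate. -/
lemma natCast_mul_absMoment_le :
    d * absMoment ≤ ENNReal.ofReal √d *
      ∫⁻ z, ENNReal.ofReal ‖z‖ ∂(stdGaussian (EuclideanSpace ℝ (Fin d))) := by
  calc d * absMoment
      = ∑ i : Fin d, ∫⁻ z, ENNReal.ofReal |z i| ∂(stdGaussian (EuclideanSpace ℝ (Fin d))) := by
        simp [lintegral_abs_eval_stdGaussian]
    _ = ∫⁻ z, ∑ i : Fin d, ENNReal.ofReal |z i| ∂(stdGaussian (EuclideanSpace ℝ (Fin d))) :=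
        (lintegral_finsetSum _ fun i _ ↦ by fun_prop).symm
    _ ≤ ∫⁻ z, ENNReal.ofReal √d * ENNReal.ofReal ‖z‖
          ∂(stdGaussian (EuclideanSpace ℝ (Fin d))) := by
        refine lintegral_mono fun z ↦ ?_
        rw [← ENNReal.ofReal_sum_of_nonneg fun i _ ↦ abs_nonneg _,
          ← ENNReal.ofReal_mul (by positivity)]
        refine ENNReal.ofReal_le_ofReal ?_
        rw [EuclideanSpace.norm_eq, ← Real.sqrt_mul (by positivity)]
        refine Real.le_sqrt_of_sq_le ?_
        simpa using sq_sum_le_card_mul_sum_sq (s := Finset.univ) (f := fun i ↦ |z i|)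
    _ = _ := lintegral_const_mul _ (by fun_prop)

lemma sq_lintegral_mul_le {α : Type*} [MeasurableSpace α] (μ : Measure α) {f g : α → ℝ≥0∞}
    (hf : AEMeasurable f μ) (hg : AEMeasurable g μ) :
    (∫⁻ a, f a * g a ∂μ) ^ 2 ≤ (∫⁻ a, f a ^ 2 ∂μ) * ∫⁻ a, g a ^ 2 ∂μ := by
  have h := ENNReal.lintegral_mul_le_Lp_mul_Lq μ Real.HolderConjugate.two_two hf hg
  have hsq (x : ℝ≥0∞) : (x ^ (1 / 2 : ℝ)) ^ 2 = x := by
    rw [← ENNReal.rpow_natCast, ← ENNReal.rpow_mul]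
    norm_num
  have h2 := pow_le_pow_left' h 2
  rw [mul_pow, hsq, hsq] at h2
  simpa using h2

/-- Cauchy–Schwarz for √N · √N_*, which dominates ‖z‖ by duality applied to ⟨z, z⟩. -/
lemma sq_lintegral_norm_le (N : Seminorm ℝ (EuclideanSpace ℝ (Fin d)))
    (hN : ∀ x, N x = 0 → x = 0) :
    (∫⁻ z, ENNReal.ofReal ‖z‖ ∂(stdGaussian (EuclideanSpace ℝ (Fin d)))) ^ 2
      ≤ (∫⁻ z, ENNReal.ofReal (N z) ∂(stdGaussian (EuclideanSpace ℝ (Fin d)))) *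
        ∫⁻ z, ENNReal.ofReal (dualNorm N z) ∂(stdGaussian (EuclideanSpace ℝ (Fin d))) := by
  have hNm := (continuous_seminorm N).measurable
  have hDm := measurable_dualNorm N hN
  have hsq (x : ℝ) : ENNReal.ofReal √x ^ 2 = ENNReal.ofReal x := by
    rcases le_total 0 x with h | h
    · rw [← ENNReal.ofReal_pow (by positivity), Real.sq_sqrt h]
    · simp [Real.sqrt_eq_zero_of_nonpos h, ENNReal.ofReal_of_nonpos h]
  have h := sq_lintegral_mul_le (stdGaussian (EuclideanSpace ℝ (Fin d)))
    (f := fun z ↦ ENNReal.ofReal √(N z)) (g := fun z ↦ ENNReal.ofReal √(dualNorm N z))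
    (by fun_prop) (by fun_prop)
  simp only [hsq] at h
  refine le_trans (pow_le_pow_left' (lintegral_mono fun z ↦ ?_) 2) h
  rw [← ENNReal.ofReal_mul (by positivity), ← Real.sqrt_mul (apply_nonneg N z)]
  refine ENNReal.ofReal_le_ofReal (Real.le_sqrt_of_sq_le ?_)
  simpa using inner_le_mul_dualNorm N hN z z

lemma natCast_mul_absMoment_sq_le (hd : 1 ≤ d) (N : Seminorm ℝ (EuclideanSpace ℝ (Fin d)))
    (hN : ∀ x, N x = 0 → x = 0) :
    d * absMoment ^ 2
      ≤ (∫⁻ z, ENNReal.ofReal (N z) ∂(stdGaussian (EuclideanSpace ℝ (Fin d)))) *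
        ∫⁻ z, ENNReal.ofReal (dualNorm N z) ∂(stdGaussian (EuclideanSpace ℝ (Fin d))) := by
  have h := pow_le_pow_left' (natCast_mul_absMoment_le (d := d)) 2
  rw [mul_pow (ENNReal.ofReal _), ← ENNReal.ofReal_pow (by positivity),
    Real.sq_sqrt (by positivity), ENNReal.ofReal_natCast, mul_pow, pow_two (d : ℝ≥0∞),
    mul_assoc] at h
  have hd0 : (d : ℝ≥0∞) ≠ 0 := by exact_mod_cast (by omega : d ≠ 0)
  exact ((ENNReal.mul_le_mul_iff_right hd0 (by simp)).1 h).trans (sq_lintegral_norm_le N hN)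

lemma sq_lintegral_seminorm_le (N : Seminorm ℝ (EuclideanSpace ℝ (Fin d))) :
    (∫⁻ z, ENNReal.ofReal (N z) ∂(stdGaussian (EuclideanSpace ℝ (Fin d)))) ^ 2
      ≤ ∫⁻ z, ENNReal.ofReal (N z ^ 2) ∂(stdGaussian (EuclideanSpace ℝ (Fin d))) := by
  have hNm := (continuous_seminorm N).measurable
  have h := sq_lintegral_mul_le (stdGaussian (EuclideanSpace ℝ (Fin d)))
    (f := fun z ↦ ENNReal.ofReal (N z)) (g := fun _ ↦ 1) (by fun_prop) (by fun_prop)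
  simpa [ENNReal.ofReal_pow (apply_nonneg N _)] using h

lemma absMoment_pow_mul_sq_le_minimaxRisk_mul (hd : 1 ≤ d)
    (N : Seminorm ℝ (EuclideanSpace ℝ (Fin d))) (hN : ∀ x, N x = 0 → x = 0) :
    2⁻¹ * absMoment ^ 4 * (d : ℝ≥0∞) ^ 2
      ≤ minimaxRisk N *
        (∫⁻ z, ENNReal.ofReal (dualNorm N z) ∂(stdGaussian (EuclideanSpace ℝ (Fin d)))) ^ 2 := by
  set B := ∫⁻ z, ENNReal.ofReal (dualNorm N z) ∂(stdGaussian (EuclideanSpace ℝ (Fin d)))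
  calc 2⁻¹ * absMoment ^ 4 * (d : ℝ≥0∞) ^ 2
      = 2⁻¹ * (d * absMoment ^ 2) ^ 2 := by ring
    _ ≤ 2⁻¹ * ((∫⁻ z, ENNReal.ofReal (N z) ∂(stdGaussian (EuclideanSpace ℝ (Fin d)))) * B) ^ 2 := by
        gcongr 2⁻¹ * ?_ ^ 2
        exact natCast_mul_absMoment_sq_le hd N hN
    _ = 2⁻¹ * (∫⁻ z, ENNReal.ofReal (N z) ∂(stdGaussian (EuclideanSpace ℝ (Fin d)))) ^ 2
          * B ^ 2 := by ring
    _ ≤ 2⁻¹ * (∫⁻ z, ENNReal.ofReal (N z ^ 2) ∂(stdGaussian (EuclideanSpace ℝ (Fin d))))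
          * B ^ 2 := by
        gcongr
        exact sq_lintegral_seminorm_le N
    _ ≤ minimaxRisk N * B ^ 2 := by
        gcongr
        exact le_iInf₂ fun est hest ↦ half_lintegral_seminorm_sq_le_iSup_risk N hest

lemma minimaxRisk_le (N : Seminorm ℝ (EuclideanSpace ℝ (Fin d))) :
    minimaxRisk N
      ≤ ∫⁻ z, ENNReal.ofReal (N z ^ 2) ∂(stdGaussian (EuclideanSpace ℝ (Fin d))) := by
  have hNm := (continuous_seminorm N).measurable
  -- With `id` the error is Z itself, whatever θ is.
  refine (iInf₂_le id measurable_id).trans (iSup_le fun θ ↦ le_of_eq ?_)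
  rw [risk, obsLaw, lintegral_map (by fun_prop) (by fun_prop)]
  simp

lemma lintegral_dualNorm_eq_gaussianWidth (N : Seminorm ℝ (EuclideanSpace ℝ (Fin d))) :
    ∫⁻ z, ENNReal.ofReal (dualNorm N z) ∂(stdGaussian (EuclideanSpace ℝ (Fin d)))
      = gaussianWidth {x | N x ≤ 1} := by
  simp only [gaussianWidth, dualNorm, Set.mem_ofPred_eq, real_inner_comm]

end GaussianLocation

theorem theorem3p1 :
    ∃ c₁ : ℝ, 0 < c₁ ∧ c₁ < 1 ∧
      ∀ d : ℕ, 1 ≤ d →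
        ∀ N : Seminorm ℝ (EuclideanSpace ℝ (Fin d)), (∀ x, N x = 0 → x = 0) →
          ENNReal.ofReal c₁ * (d : ℝ≥0∞) ^ 2 /
              (∫⁻ z, ENNReal.ofReal (GaussianLocation.dualNorm N z)
                ∂(stdGaussian (EuclideanSpace ℝ (Fin d)))) ^ 2
            ≤ GaussianLocation.minimaxRisk N ∧
          GaussianLocation.minimaxRisk N
            ≤ ∫⁻ z, ENNReal.ofReal (N z ^ 2) ∂(stdGaussian (EuclideanSpace ℝ (Fin d))) ∧
          ∫⁻ z, ENNReal.ofReal (GaussianLocation.dualNorm N z)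
                ∂(stdGaussian (EuclideanSpace ℝ (Fin d)))
            = GaussianLocation.gaussianWidth {x | N x ≤ 1} := by
  -- Picking c strictly below this minimum makes it real and less than 1; only positivity of
  -- `absMoment` is needed, not its value or finiteness.
  have hpos : (0 : ℝ≥0∞) < min 1 (2⁻¹ * GaussianLocation.absMoment ^ 4) :=
    lt_min one_pos (ENNReal.mul_pos (by simp)
      (pow_ne_zero _ GaussianLocation.absMoment_pos.ne'))
  obtain ⟨c, hc0, hc⟩ := ENNReal.lt_iff_exists_nnreal_btwn.1 hpos
  obtain ⟨hc1, hc2⟩ := lt_min_iff.1 hc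
  refine ⟨c, by exact_mod_cast hc0, by exact_mod_cast hc1, fun d hd N hN ↦ ⟨?_,
    GaussianLocation.minimaxRisk_le N, GaussianLocation.lintegral_dualNorm_eq_gaussianWidth N⟩⟩
  refine ENNReal.div_le_of_le_mul (le_trans ?_
    (GaussianLocation.absMoment_pow_mul_sq_le_minimaxRisk_mul hd N hN))
  rw [ENNReal.ofReal_coe_nnreal]
  gcongr
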